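/- For $n\ge 1$ and $R>0$ let $\gamma_R$ be the discrete Gaussian on $\mathbb Z^n$, $\gamma_R(x)=e^{-\pi\|x\|_2^2/R^2}\big/\sum_{y\in\mathbb Z^n}e^{-\pi\|y\|_2^2/R^2}$. A probability measure $\mu$ on $\mathbb Z^n$ is an $\alpha$-dense piece of $\gamma_R$ if $\mu(x)\le\alpha^{-1}\gamma_R(x)$ for all $x\in\mathbb Z^n$. On $\mathbb T^n=(\mathbb R/\mathbb Z)^n$, $\|\zeta\|_{\mathbb T^n}$ denotes the Euclidean distance from $\zeta$ to $\mathbb Z^n$, and $\operatorname{dist}_{\mathbb T^n}$ is the corresponding distance. Put $\widehat\mu(\zeta)=\sum_{x\in\mathbb Z^n}\mu(x)e^{-2\pi i\langle\zeta,x\rangle}$ and $$\Lambda_{K,\le\kappa}(\mu)=\{\zeta\in\mathbb T^n:\ |\widehat\mu(\zeta)|\ge 1-1/K,\ \|\zeta\|_{\mathbb T^n}\le\kappa\}.$$ **Theorem (Near-origin Large Spectrum Structure Theorem).** Let $n\ge 1$, $R\ge 2$, $K\ge 2$, $\alpha\in(0,1]$, $\kappa>0$, $B\ge 1$, and let $\mu$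 be an $\alpha$-dense piece of $\gamma_R$ on $\mathbb Z^n$. Set $$S:=\log_2(2/\alpha),\qquad \rho:=\frac{100\,B\,S^{3/2}\kappa}{\sqrt K},$$ and assume that $$\frac{3\sqrt S}{R}\le\kappa\le\sqrt{\frac{2\pi}{K\ln(8n)}},\qquad Q\ge\frac{2\sqrt{2nS}\,\kappa}{\rho},$$ where $Q$ is a real number (for instance an integer). Then there exist an integer $\ell$ with $0\le\ell\le\dfrac{2S}{\log_2(2B)}$ and frequencies $\eta_1,\dots,\eta_\ell\in Q^{-1}\mathbb Z^n\cap[-1/2,1/2)^n$ such that every $\zeta\in\Lambda_{K,\le\kappa}(\mu)$ satisfies $$\operatorname{dist}_{\mathbb T^n}\big(\zeta,\operatorname{span}_{\mathbb R}\{\eta_1,\dots,\eta_\ell\}\big)\le 2\rho,$$ where $\operatorname{span}_{\mathbb R}\{\eta_1,\dots,\eta_\ell\}\subseteq\mathbb R^n$ is viewed as a subtorus of $\mathbb T^n$, that is, as its image under $\mathbb R^n\to\mathbb R^n/\mathbb Z^n$ (the image of $\{0\}$ if $\ell=0$). -/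

import Mathlib

noncomputable section

namespace NearOriginSpectrum

/-- The Gaussian weight `exp (-π ‖x‖₂² / R²)` of a lattice point `x ∈ ℤⁿ`. -/
def gaussianWeight (n : ℕ) (R : ℝ) (x : Fin n → ℤ) : ℝ :=
  Real.exp (-Real.pi * (∑ i, (x i : ℝ) ^ 2) / R ^ 2)

theorem gaussianWeight_pos (n : ℕ) (R : ℝ) (x : Fin n → ℤ) : 0 < gaussianWeight n R x :=
  Real.exp_pos _

theorem summable_prod_fin {f : ℤ → ℝ} (hf : Summable f) (h0 : ∀ k, 0 ≤ f k) (n : ℕ) :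
    Summable fun x : Fin n → ℤ => ∏ i, f (x i) := by
  induction n with
  | zero => exact (hasSum_fintype _).summable
  | succ n ih =>
    have h := hf.mul_of_nonneg ih h0 (fun x => Finset.prod_nonneg fun i _ => h0 (x i))
    rw [← (Fin.consEquiv fun _ : Fin (n + 1) => ℤ).summable_iff]
    refine h.congr fun p => ?_
    simp [Fin.consEquiv, Fin.prod_univ_succ]

theorem summable_gaussianWeight (n : ℕ) {R : ℝ} (hR : 0 < R) :
    Summable (gaussianWeight n R) := by
  have h1 : Summable fun k : ℤ => Real.exp (-Real.pi * (k : ℝ) ^ 2 / R ^ 2) := by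
    have h := summable_pow_mul_jacobiTheta₂_term_bound 0 (T := 1 / R ^ 2) (by positivity) 0
    refine h.congr fun k => ?_
    simp only [pow_zero, one_mul]
    congr 1
    ring
  refine (summable_prod_fin h1 (fun _ => (Real.exp_pos _).le) n).congr fun x => ?_
  rw [← Real.exp_sum, gaussianWeight, Finset.mul_sum, Finset.sum_div]

/-- The centered isotropic discrete Gaussian `γ_R` on `ℤⁿ`: the probability measure whose mass at
`x` is `exp (-π ‖x‖₂² / R²) / ∑ y, exp (-π ‖y‖₂² / R²)`. -/
def discreteGaussian (n : ℕ) (R : ℝ) (hR : 0 < R) : PMF (Fin n → ℤ) :=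
  ⟨fun x => ENNReal.ofReal (gaussianWeight n R x / ∑' y, gaussianWeight n R y), by
    have hs := summable_gaussianWeight n hR
    have hpos : 0 < ∑' y, gaussianWeight n R y :=
      hs.tsum_pos (fun x => (gaussianWeight_pos n R x).le) 0 (gaussianWeight_pos n R 0)
    have h1 : HasSum (fun x => gaussianWeight n R x / ∑' y, gaussianWeight n R y) 1 := by
      simpa [div_self hpos.ne'] using hs.hasSum.div_const (∑' y, gaussianWeight n R y)
    have h2 := ENNReal.ofReal_tsum_of_nonneg
      (fun x => div_nonneg (gaussianWeight_pos n R x).le hpos.le) h1.summable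
    rw [h1.tsum_eq, ENNReal.ofReal_one] at h2
    exact h2 ▸ ENNReal.summable.hasSum⟩

/-- `μ` is an `α`-dense piece of `ν`: pointwise, `μ x ≤ α⁻¹ ν x`. -/
def IsDensePiece {X : Type*} (α : ℝ) (μ ν : PMF X) : Prop :=
  ∀ x, (μ x).toReal ≤ α⁻¹ * (ν x).toReal

/-- The torus `𝕋ⁿ = (ℝ/ℤ)ⁿ` with its Euclidean metric: `‖ζ‖ = (∑ i, ‖ζ i‖²)^(1/2)`, where `‖ζ i‖` is
the distance to the nearest integer, which is the Euclidean distance of any lift of `ζ` to `ℤⁿ`. -/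
abbrev Torus (n : ℕ) : Type := PiLp 2 fun _ : Fin n => UnitAddCircle

/-- The projection `ℝⁿ → 𝕋ⁿ = ℝⁿ/ℤⁿ`. -/
def toTorus {n : ℕ} (v : EuclideanSpace ℝ (Fin n)) : Torus n :=
  WithLp.toLp 2 fun i => (v i : UnitAddCircle)

/-- The pairing `⟨ζ, x⟩ = ∑ i, x i ζ i ∈ ℝ/ℤ` of `ζ ∈ 𝕋ⁿ` with `x ∈ ℤⁿ`. -/
def pairing {n : ℕ} (ζ : Torus n) (x : Fin n → ℤ) : UnitAddCircle :=
  ∑ i, x i • ζ i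

/-- The Fourier transform `∑ x, μ(x) e(-⟨ζ, x⟩)`, where `e(t) = exp (2 π i t)`. -/
def fourierTransform {n : ℕ} (μ : PMF (Fin n → ℤ)) (ζ : Torus n) : ℂ :=
  ∑' x, ((μ x).toReal : ℂ) * (AddCircle.toCircle (-pairing ζ x) : ℂ)

/-- The large spectrum `Λ_K(μ)`. -/
def largeSpectrum {n : ℕ} (K : ℝ) (μ : PMF (Fin n → ℤ)) : Set (Torus n) :=
  {ζ | 1 - 1 / K ≤ ‖fourierTransform μ ζ‖}

/-- The near-origin large spectrum `Λ_{K,≤κ}(μ)`. -/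
def nearOriginLargeSpectrum {n : ℕ} (K κ : ℝ) (μ : PMF (Fin n → ℤ)) : Set (Torus n) :=
  {ζ | ζ ∈ largeSpectrum K μ ∧ ‖ζ‖ ≤ κ}

/-- The grid `Q⁻¹ ℤⁿ ∩ [-1/2, 1/2)ⁿ`. -/
def boundedGrid (n : ℕ) (Q : ℝ) : Set (EuclideanSpace ℝ (Fin n)) :=
  {v | (∃ k : Fin n → ℤ, ∀ i, v i = Q⁻¹ * (k i : ℝ)) ∧ ∀ i, -(1 / 2) ≤ v i ∧ v i < 1 / 2}

/-- The real span of `η₁, …, η_ℓ ∈ ℝⁿ`, viewed as a subtorus of `𝕋ⁿ` (the image of the span in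
`ℝⁿ` under the projection). -/
def spanTorus {n ℓ : ℕ} (η : Fin ℓ → EuclideanSpace ℝ (Fin n)) : Set (Torus n) :=
  toTorus '' (Submodule.span ℝ (Set.range η) : Set (EuclideanSpace ℝ (Fin n)))

end NearOriginSpectrum

end

/-!
The proof compares two estimates for the mean of a product of periodic bumps.

A frequency `z ∈ ℝⁿ` whose class lies in the large spectrum is one for which `⟨z, x⟩`, with `x` of
law `μ`, is concentrated modulo `1` around a phase `θ`: the mean of `1 - cos (2π (⟨z, x⟩ - θ))` is
at most `1 / K`. As `‖z‖ ≤ κ`, this survives, up to a constant, when an independent continuous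
Gaussian vector of width `r = √(2 log (8n) / π)` is added to `x` (`le_norm_charFun_mollify`). Hence,
for frequencies `z₀, …, z_{m-1}` of this kind, Jensen's inequality bounds below the mean of
`∏ exp (-(K / 8) (1 - cos (2π (⟨z_j, u⟩ - θ_j))))` under the mollified law by `exp (-7 m / 4)`
(`exists_phases_le_lintegral_prod_bump`).

The width `r` is above the smoothing parameter of `ℤⁿ`, so the mollification of `γ_R` is at most
twice the continuous Gaussian of width `T = √(R² + r²)`, and the mollification of `μ` is at most
`2 / α` times it (`lintegral_mollify_le`, `theta_pow_le_two`). Under that Gaussian, if each `z_j` is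
at distance at least `ρ` from the span of its predecessors, then conditionally on the earlier
pairings `⟨z_j, u⟩` is a Gaussian of width at least `T ρ`; wrapped around the circle it has density
at most `2 (1 + 1 / (T ρ))`, so each bump contributes a small factor (`lintegral_prod_bump_le`).
Comparing the two estimates gives `(2 B) ^ m ≤ 2 / α` (`two_mul_pow_le`).

Therefore a greedy choice of frequencies, each further than `ρ` from the span of the previous ones,
stops after at most `S / log₂ (2B)` steps, with a subspace `W` to which the lifted spectrum is
`ρ`-close (`exists_prefixSpan_close`). Halving an orthonormal basis of `W` and rounding it to the
grid moves the projections, which have norm at most `κ`, by at most another `ρ`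
(`exists_boundedGrid_span_close`). If `κ ≤ 2ρ` there is nothing to do, since the origin is close
enough; otherwise `√K > 200 B S^(3/2)`, which is what makes the factors small.
-/

open MeasureTheory
open scoped ENNReal

namespace NearOriginSpectrum

/-! ### Theta sums -/

/-- The theta sum `∑ exp (-π a k²)` over `k ∈ ℤ`. -/
noncomputable def theta (a : ℝ) : ℝ := ∑' k : ℤ, Real.exp (-Real.pi * a * (k : ℝ) ^ 2)

theorem summable_gaussian_shift {a : ℝ} (ha : 0 < a) (v : ℝ) :
    Summable fun k : ℤ => Real.exp (-Real.pi * ((k : ℝ) - v) ^ 2 / a) := by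
  have h := summable_pow_mul_jacobiTheta₂_term_bound (|v| / a) (T := 1 / a) (by positivity) 0
  refine h.of_nonneg_of_le (fun k => (Real.exp_pos _).le) fun k => ?_
  rw [pow_zero, one_mul]
  refine Real.exp_le_exp.mpr ?_
  have h1 : (k : ℝ) * v ≤ |(k : ℝ)| * |v| := by rw [← abs_mul]; exact le_abs_self _
  have h2 : -Real.pi * ((k : ℝ) - v) ^ 2 / a ≤
      -Real.pi * ((k : ℝ) ^ 2 - 2 * (|(k : ℝ)| * |v|)) / a := by
    refine div_le_div_of_nonneg_right ?_ ha.le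
    nlinarith [Real.pi_pos, sq_nonneg v]
  refine h2.trans (le_of_eq ?_)
  push_cast
  field_simp

theorem summable_theta {a : ℝ} (ha : 0 < a) :
    Summable fun k : ℤ => Real.exp (-Real.pi * a * (k : ℝ) ^ 2) := by
  refine (summable_gaussian_shift (inv_pos.mpr ha) 0).congr fun k => ?_
  rw [sub_zero, div_inv_eq_mul]
  ring_nf

theorem one_le_theta {a : ℝ} (ha : 0 < a) : 1 ≤ theta a := by
  have := (summable_theta ha).le_tsum 0 fun k _ => (Real.exp_pos _).le
  simpa [theta] using this

/-- Poisson summation shows that a Gaussian sum over a shifted lattice is largest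
without the shift. -/
theorem tsum_gaussian_shift_le {a : ℝ} (ha : 0 < a) (v : ℝ) :
    ∑' k : ℤ, Real.exp (-Real.pi * ((k : ℝ) - v) ^ 2 / a) ≤ √a * theta a := by
  have h := Complex.tsum_exp_neg_quadratic (a := a) (by simpa using ha) (Complex.I * v)
  have h1 : (∑' k : ℤ, Complex.exp (-Real.pi / a * (k + Complex.I * (Complex.I * v)) ^ 2)) =
      ((∑' k : ℤ, Real.exp (-Real.pi * ((k : ℝ) - v) ^ 2 / a) : ℝ) : ℂ) := by
    rw [Complex.ofReal_tsum]
    refine tsum_congr fun k => ?_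
    push_cast
    congr 1
    rw [← mul_assoc, Complex.I_mul_I]
    ring
  have h2 : ((a : ℂ) ^ (1 / 2 : ℂ)) = ((√a : ℝ) : ℂ) := by
    rw [Real.sqrt_eq_rpow, Complex.ofReal_cpow ha.le]
    simp
  have hs : 0 < √a := Real.sqrt_pos.mpr ha
  rw [h1, h2] at h
  have h3 : ((∑' k : ℤ, Real.exp (-Real.pi * ((k : ℝ) - v) ^ 2 / a) : ℝ) : ℂ) =
      (√a : ℝ) * ∑' n : ℤ, Complex.exp (-Real.pi * a * n ^ 2 +
        2 * Real.pi * (Complex.I * v) * n) := by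
    rw [h, ← mul_assoc, mul_one_div_cancel (by exact_mod_cast hs.ne'), one_mul]
  have hn : ∀ n : ℤ, ‖Complex.exp (-Real.pi * a * n ^ 2 + 2 * Real.pi * (Complex.I * v) * n)‖ =
      Real.exp (-Real.pi * a * (n : ℝ) ^ 2) := by
    intro n
    rw [Complex.norm_exp]
    congr 1
    simp [pow_two]
  have h4 : ‖∑' n : ℤ, Complex.exp (-Real.pi * a * n ^ 2 +
      2 * Real.pi * (Complex.I * v) * n)‖ ≤ theta a := by
    refine (norm_tsum_le_tsum_norm ?_).trans_eq (tsum_congr hn)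
    exact (summable_theta ha).congr fun k => (hn k).symm
  have h5 := congrArg norm h3
  rw [Complex.norm_real, norm_mul, Complex.norm_real, Real.norm_of_nonneg hs.le,
    Real.norm_of_nonneg (tsum_nonneg fun _ => (Real.exp_pos _).le)] at h5
  rw [h5]
  gcongr

theorem theta_inv {a : ℝ} (ha : 0 < a) : theta a⁻¹ = √a * theta a := by
  have h := Real.tsum_exp_neg_mul_int_sq ha
  rw [← Real.sqrt_eq_rpow] at h
  have hs : 0 < √a := Real.sqrt_pos.mpr ha
  rw [theta, theta, h, ← mul_assoc, mul_one_div_cancel hs.ne', one_mul]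
  exact tsum_congr fun k => by rw [div_eq_mul_inv]

theorem theta_le_of_exp_le {a q : ℝ} (ha : 0 < a) (hq : Real.exp (-Real.pi * a) ≤ q)
    (hq1 : q < 1) : theta a ≤ 1 + 2 * q / (1 - q) := by
  have h := norm_jacobiTheta_sub_one_le (τ := (a : ℂ) * Complex.I) (by simpa using ha)
  have h1 : jacobiTheta ((a : ℂ) * Complex.I) = (theta a : ℂ) := by
    rw [jacobiTheta, theta, Complex.ofReal_tsum]
    refine tsum_congr fun k => ?_
    push_cast
    congr 1
    linear_combination (Real.pi * k ^ 2 * a : ℂ) * Complex.I_mul_I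
  rw [h1] at h
  have him : ((a : ℂ) * Complex.I).im = a := by simp
  rw [him] at h
  have h2 : ‖((theta a : ℂ) - 1)‖ = |theta a - 1| := by
    rw [← Complex.ofReal_one, ← Complex.ofReal_sub, Complex.norm_real, Real.norm_eq_abs]
  rw [h2] at h
  have h3 : 2 / (1 - Real.exp (-Real.pi * a)) * Real.exp (-Real.pi * a) ≤ 2 / (1 - q) * q := by
    have : 0 < 1 - q := by linarith
    gcongr
  have h4 := (le_abs_self _).trans (h.trans h3)
  have h5 : 2 / (1 - q) * q = 2 * q / (1 - q) := by ring
  linarith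

theorem theta_le_two {a : ℝ} (ha : 1 ≤ a) : theta a ≤ 2 := by
  have h1 : Real.exp (-Real.pi * a) ≤ 1 / 4 := by
    have h : (4 : ℝ) ≤ Real.exp (Real.pi * a) := by
      have := Real.add_one_le_exp (Real.pi * a)
      nlinarith [Real.pi_gt_three]
    rw [neg_mul, Real.exp_neg, ← one_div]
    exact one_div_le_one_div_of_le (by norm_num) h
  refine (theta_le_of_exp_le (by linarith) h1 (by norm_num)).trans ?_
  norm_num

theorem theta_sq_le {w : ℝ} (hw : 0 < w) : theta (w ^ 2) ≤ 2 * (1 + 1 / w) := by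
  have hw' : 0 < 1 / w := by positivity
  rcases le_total 1 w with h | h
  · have := theta_le_two (a := w ^ 2) (by nlinarith)
    linarith
  · have h1 := theta_inv (a := (w ^ 2)⁻¹) (by positivity)
    rw [inv_inv, Real.sqrt_inv, Real.sqrt_sq hw.le] at h1
    have h2 := theta_le_two (a := (w ^ 2)⁻¹) ((one_le_inv₀ (by positivity)).mpr (by nlinarith))
    rw [h1, ← one_div]
    nlinarith

theorem ennreal_tsum_prod {n : ℕ} (f : Fin n → ℤ → ℝ≥0∞) :
    ∑' x : Fin n → ℤ, ∏ i, f i (x i) = ∏ i, ∑' k, f i k := by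
  induction n with
  | zero => simp
  | succ n ih =>
    rw [← (Fin.consEquiv fun _ : Fin (n + 1) => ℤ).tsum_eq, ENNReal.tsum_prod',
      Fin.prod_univ_succ, ← ih, ← ENNReal.tsum_mul_right]
    refine tsum_congr fun k => ?_
    rw [← ENNReal.tsum_mul_left]
    refine tsum_congr fun x => ?_
    simp [Fin.consEquiv, Fin.prod_univ_succ]

/-! ### Continuous Gaussian measures -/

section Gauss

variable {V : Type*} [NormedAddCommGroup V] [InnerProductSpace ℝ V]

/-- The Gaussian density `T ^ (-dim V) exp (-π ‖u‖² / T²)` of width `T`. -/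
noncomputable def gaussDensity (T : ℝ) (u : V) : ℝ :=
  (T ^ Module.finrank ℝ V)⁻¹ * Real.exp (-Real.pi * ‖u‖ ^ 2 / T ^ 2)

theorem gaussDensity_nonneg {T : ℝ} (hT : 0 < T) (u : V) : 0 ≤ gaussDensity T u :=
  mul_nonneg (inv_nonneg.mpr (pow_nonneg hT.le _)) (Real.exp_pos _).le

theorem continuous_gaussDensity (T : ℝ) : Continuous (gaussDensity T : V → ℝ) := by
  unfold gaussDensity
  fun_prop

variable [MeasurableSpace V] [BorelSpace V]

theorem measurable_gaussDensity (T : ℝ) :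
    Measurable fun u : V => ENNReal.ofReal (gaussDensity T u) :=
  (continuous_gaussDensity T).measurable.ennreal_ofReal

variable [FiniteDimensional ℝ V]

variable (V) in
/-- The centered Gaussian probability measure of width `T`, that is, of variance `T² / (2π)` in
each direction. -/
noncomputable def gaussMeasure (T : ℝ) : Measure V :=
  volume.withDensity fun u => ENNReal.ofReal (gaussDensity T u)

theorem integral_gaussDensity {T : ℝ} (hT : 0 < T) : ∫ u : V, gaussDensity T u = 1 := by
  have h := GaussianFourier.integral_rexp_neg_mul_sq_norm (V := V) (b := Real.pi / T ^ 2)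
    (by positivity)
  have h1 : (Real.pi / (Real.pi / T ^ 2)) ^ (Module.finrank ℝ V / 2 : ℝ) =
      T ^ Module.finrank ℝ V := by
    rw [div_div_cancel₀ Real.pi_pos.ne', ← Real.rpow_natCast T 2, ← Real.rpow_mul hT.le,
      ← Real.rpow_natCast T]
    congr 1
    push_cast
    ring
  rw [h1] at h
  simp only [gaussDensity]
  rw [integral_const_mul]
  have h2 : ∀ u : V, -Real.pi * ‖u‖ ^ 2 / T ^ 2 = -(Real.pi / T ^ 2) * ‖u‖ ^ 2 := fun u => by ring
  simp only [h2]
  rw [h, inv_mul_cancel₀ (by positivity)]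

theorem isProbabilityMeasure_gaussMeasure {T : ℝ} (hT : 0 < T) :
    IsProbabilityMeasure (gaussMeasure V T) := by
  constructor
  have hi : Integrable (gaussDensity T : V → ℝ) :=
    Integrable.of_integral_ne_zero (by rw [integral_gaussDensity hT]; exact one_ne_zero)
  rw [gaussMeasure, withDensity_apply _ MeasurableSet.univ, Measure.restrict_univ,
    ← ofReal_integral_eq_lintegral_ofReal hi (ae_of_all _ (gaussDensity_nonneg hT)),
    integral_gaussDensity hT, ENNReal.ofReal_one]

theorem charFun_gaussMeasure {T : ℝ} (hT : 0 < T) (t : V) :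
    charFun (gaussMeasure V T) t =
      (Real.exp (-(T ^ 2 * ‖t‖ ^ 2 / (4 * Real.pi))) : ℂ) := by
  have h := GaussianFourier.integral_cexp_neg_mul_sq_norm_add (V := V)
    (b := ((Real.pi / T ^ 2 : ℝ) : ℂ)) (by rw [Complex.ofReal_re]; positivity) Complex.I t
  have h1 : ((Real.pi : ℂ) / ((Real.pi / T ^ 2 : ℝ) : ℂ)) ^ (Module.finrank ℝ V / 2 : ℂ) =
      ((T ^ Module.finrank ℝ V : ℝ) : ℂ) := by
    rw [← Complex.ofReal_div, div_div_cancel₀ Real.pi_pos.ne']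
    have : ((Module.finrank ℝ V / 2 : ℂ)) = ((Module.finrank ℝ V / 2 : ℝ) : ℂ) := by push_cast; ring
    rw [this, ← Complex.ofReal_cpow (by positivity), ← Real.rpow_natCast T 2,
      ← Real.rpow_mul hT.le, ← Real.rpow_natCast T]
    congr 2
    push_cast
    ring
  rw [h1] at h
  rw [charFun_apply, gaussMeasure, integral_withDensity_eq_integral_toReal_smul
    (measurable_gaussDensity T) (ae_of_all _ fun _ => ENNReal.ofReal_lt_top)]
  have h2 : ∀ u : V, (ENNReal.ofReal (gaussDensity T u)).toReal •
      Complex.exp ((inner ℝ u t : ℝ) * Complex.I) =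
      ((T ^ Module.finrank ℝ V : ℝ) : ℂ)⁻¹ *
        Complex.exp (-((Real.pi / T ^ 2 : ℝ) : ℂ) * ‖u‖ ^ 2 + Complex.I * (inner ℝ t u : ℝ)) := by
    intro u
    rw [ENNReal.toReal_ofReal (gaussDensity_nonneg hT u), gaussDensity, Complex.real_smul,
      Complex.exp_add, real_inner_comm]
    push_cast
    rw [mul_assoc, mul_comm Complex.I]
    congr 3
    ring_nf
  simp only [h2]
  rw [integral_const_mul, h, ← mul_assoc, inv_mul_cancel₀, one_mul, Complex.ofReal_exp]
  · congr 1
    have hT' : (T : ℂ) ≠ 0 := by exact_mod_cast hT.ne'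
    have hpi : (Real.pi : ℂ) ≠ 0 := by exact_mod_cast Real.pi_pos.ne'
    push_cast
    rw [Complex.I_sq]
    field_simp
  · have : (T ^ Module.finrank ℝ V) ≠ 0 := by positivity
    exact_mod_cast this

/-- Resampling the component of a Gaussian vector along `d`: removing it and putting back an
independent one-dimensional Gaussian, scaled to the right width, does not change the law. -/
theorem map_resample_gaussMeasure {T : ℝ} (hT : 0 < T) {d : V} (hd : d ≠ 0) :
    ((gaussMeasure V T).prod (gaussMeasure ℝ (T * ‖d‖))).map
      (fun p : V × ℝ => p.1 + ((p.2 - inner ℝ d p.1) / ‖d‖ ^ 2) • d) = gaussMeasure V T := by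
  have hd' : 0 < ‖d‖ := norm_pos_iff.mpr hd
  have hTd : 0 < T * ‖d‖ := mul_pos hT hd'
  have := isProbabilityMeasure_gaussMeasure (V := V) hT
  have := isProbabilityMeasure_gaussMeasure (V := ℝ) hTd
  have hm : Measurable (fun p : V × ℝ => p.1 + ((p.2 - inner ℝ d p.1) / ‖d‖ ^ 2) • d) :=
    Continuous.measurable (by fun_prop)
  have := Measure.isProbabilityMeasure_map (μ := (gaussMeasure V T).prod
    (gaussMeasure ℝ (T * ‖d‖))) hm.aemeasurable
  refine Measure.ext_of_charFun (funext fun t => ?_)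
  rw [charFun_apply, integral_map hm.aemeasurable
    (Continuous.aestronglyMeasurable (by fun_prop)), charFun_gaussMeasure hT]
  set c : ℝ := inner ℝ d t / ‖d‖ ^ 2 with hc
  have h1 : ∀ p : V × ℝ, Complex.exp ((inner ℝ
      (p.1 + ((p.2 - inner ℝ d p.1) / ‖d‖ ^ 2) • d) t : ℝ) * Complex.I) =
      Complex.exp ((inner ℝ p.1 (t - c • d) : ℝ) * Complex.I) *
        Complex.exp ((inner ℝ p.2 c : ℝ) * Complex.I) := by
    intro p
    rw [← Complex.exp_add, ← add_mul, ← Complex.ofReal_add]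
    congr 3
    rw [inner_add_left, inner_sub_right, inner_smul_left, inner_smul_right,
      real_inner_comm d p.1, hc]
    simp
    ring
  simp only [h1]
  rw [integral_prod_mul (fun u : V => Complex.exp ((inner ℝ u (t - c • d) : ℝ) * Complex.I))
    (fun s : ℝ => Complex.exp ((inner ℝ s c : ℝ) * Complex.I)), ← charFun_apply, ← charFun_apply,
    charFun_gaussMeasure hT, charFun_gaussMeasure hTd, ← Complex.ofReal_mul, ← Real.exp_add]
  congr 2
  have h2 : ‖t - c • d‖ ^ 2 = ‖t‖ ^ 2 - c ^ 2 * ‖d‖ ^ 2 := by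
    rw [norm_sub_sq_real, inner_smul_right, norm_smul, mul_pow, Real.norm_eq_abs, sq_abs,
      real_inner_comm]
    have : inner ℝ d t = c * ‖d‖ ^ 2 := by rw [hc]; field_simp
    rw [this]
    ring
  rw [h2, Real.norm_eq_abs, sq_abs]
  ring

end Gauss

/-! ### Periodic bumps against one-dimensional Gaussians -/

/-- The `1`-periodic bump `exp (-lam (1 - cos 2πt))`, concentrated near the integers. -/
noncomputable def bump (lam t : ℝ) : ℝ := Real.exp (-lam * (1 - Real.cos (2 * Real.pi * t)))

theorem bump_add_int (lam t : ℝ) (k : ℤ) : bump lam (t + k) = bump lam t := by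
  have h : 2 * Real.pi * (t + k) = 2 * Real.pi * t + k * (2 * Real.pi) := by ring
  rw [bump, bump, h, Real.cos_add_int_mul_two_pi]

theorem continuous_bump (lam : ℝ) : Continuous (bump lam) := by
  unfold bump
  fun_prop

theorem bump_pos (lam t : ℝ) : 0 < bump lam t := Real.exp_pos _

theorem bump_le_gaussian {lam t : ℝ} (hlam : 0 < lam) (ht : |t| ≤ 1 / 2) :
    bump lam t ≤ Real.exp (-(8 * lam) * t ^ 2) := by
  refine Real.exp_le_exp.mpr ?_
  have h1 : Real.cos (2 * Real.pi * t) ≤ 1 - 2 / Real.pi ^ 2 * (2 * Real.pi * t) ^ 2 := by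
    refine Real.cos_le_one_sub_mul_cos_sq ?_
    rw [abs_mul, abs_of_pos Real.two_pi_pos]
    nlinarith [Real.pi_pos]
  have h2 : 2 / Real.pi ^ 2 * (2 * Real.pi * t) ^ 2 = 8 * t ^ 2 := by
    field_simp
    ring
  rw [h2] at h1
  nlinarith

theorem lintegral_bump_le {lam : ℝ} (hlam : 0 < lam) :
    ∫⁻ t in Set.Ioc (-(1 / 2) : ℝ) (-(1 / 2) + 1), ENNReal.ofReal (bump lam t) ≤
      ENNReal.ofReal √(Real.pi / (8 * lam)) := by
  rw [← integral_gaussian, ofReal_integral_eq_lintegral_ofReal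
    (integrable_exp_neg_mul_sq (by positivity)) (ae_of_all _ fun _ => (Real.exp_pos _).le)]
  refine (setLIntegral_mono' measurableSet_Ioc fun t ht => ?_).trans (setLIntegral_le_lintegral _ _)
  refine ENNReal.ofReal_le_ofReal (bump_le_gaussian hlam ?_)
  rw [abs_le]
  exact ⟨ht.1.le, by linarith [ht.2]⟩

/-- Wrapping a Gaussian of width `w` around the circle gives a density bounded by `theta (w²)`, so
the mean of any translate of the bump exceeds its integral over a period by at most this factor. -/
theorem lintegral_bump_gaussMeasure_le {lam w : ℝ} (hlam : 0 < lam) (hw : 0 < w) (φ : ℝ) :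
    ∫⁻ t, ENNReal.ofReal (bump lam (φ + t)) ∂(gaussMeasure ℝ w) ≤
      ENNReal.ofReal (theta (w ^ 2) * √(Real.pi / (8 * lam))) := by
  have hmb : Measurable fun t => ENNReal.ofReal (bump lam t) :=
    (continuous_bump lam).measurable.ennreal_ofReal
  have hmb' : Measurable fun t => ENNReal.ofReal (bump lam (φ + t)) :=
    hmb.comp (measurable_const_add φ)
  rw [gaussMeasure, lintegral_withDensity_eq_lintegral_mul _ (measurable_gaussDensity w) hmb']
  simp only [Pi.mul_apply]
  rw [← lintegral_add_right_eq_self _ (-φ)]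
  simp only [add_neg_cancel_comm_assoc]
  rw [(isAddFundamentalDomain_Ioc one_pos (-(1 / 2) : ℝ) volume).lintegral_eq_tsum'']
  have hk : ∀ k : ℤ, ∀ t : ℝ, ENNReal.ofReal (gaussDensity w (t + k + -φ)) *
      ENNReal.ofReal (bump lam (t + k)) = ENNReal.ofReal (w⁻¹ * Real.exp (-Real.pi *
        ((k : ℝ) - (φ - t)) ^ 2 / w ^ 2)) * ENNReal.ofReal (bump lam t) := by
    intro k t
    rw [bump_add_int, gaussDensity, Module.finrank_self, pow_one, Real.norm_eq_abs, sq_abs]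
    congr 6
    ring
  let e : ℤ ≃ AddSubgroup.zmultiples (1 : ℝ) := Equiv.ofBijective
    (fun k => ⟨(k : ℝ), AddSubgroup.mem_zmultiples_iff.mpr ⟨k, by simp⟩⟩)
    ⟨fun a b h => by simpa using h, fun ⟨x, hx⟩ => by
      obtain ⟨k, hk⟩ := AddSubgroup.mem_zmultiples_iff.mp hx
      exact ⟨k, by simpa using hk⟩⟩
  rw [← e.tsum_eq]
  have he : ∀ (k : ℤ) (t : ℝ), (e k +ᵥ t) = t + k := fun k t => by
    rw [add_comm]; rfl
  simp only [he, hk]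
  rw [← lintegral_tsum fun k => by
    refine Measurable.aemeasurable (Measurable.mul ?_ hmb)
    exact (Continuous.measurable (by fun_prop)).ennreal_ofReal]
  have hs : ∀ t : ℝ, ∑' k : ℤ, ENNReal.ofReal (w⁻¹ * Real.exp (-Real.pi *
      ((k : ℝ) - (φ - t)) ^ 2 / w ^ 2)) * ENNReal.ofReal (bump lam t) ≤
      ENNReal.ofReal (theta (w ^ 2)) * ENNReal.ofReal (bump lam t) := by
    intro t
    rw [ENNReal.tsum_mul_right]
    gcongr
    have hsum := summable_gaussian_shift (a := w ^ 2) (by positivity) (φ - t)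
    rw [← ENNReal.ofReal_tsum_of_nonneg (fun k => by positivity) (hsum.mul_left _),
      tsum_mul_left]
    refine ENNReal.ofReal_le_ofReal ?_
    have := tsum_gaussian_shift_le (a := w ^ 2) (by positivity) (φ - t)
    rw [Real.sqrt_sq hw.le] at this
    rwa [inv_mul_le_iff₀ hw]
  refine (lintegral_mono hs).trans ?_
  rw [lintegral_const_mul _ hmb, ENNReal.ofReal_mul
    (zero_le_one.trans (one_le_theta (by positivity)))]
  gcongr
  exact lintegral_bump_le hlam

/-- If each `z j` has a component `d j` of norm at least `ρ` orthogonal to its predecessors, then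
conditionally on the previous pairings the pairing of `z j` with a Gaussian vector of width `T`
still has width at least `T * ρ`, so every bump gains the one-dimensional factor. -/
theorem lintegral_prod_bump_le {V : Type*} [NormedAddCommGroup V] [InnerProductSpace ℝ V]
    [MeasurableSpace V] [BorelSpace V] [FiniteDimensional ℝ V] {T ρ lam : ℝ} (hT : 0 < T)
    (hρ : 0 < ρ) (hlam : 0 < lam) (z d : ℕ → V) (θ : ℕ → ℝ) (m : ℕ)
    (horth : ∀ j < m, ∀ i < j, inner ℝ (d j) (z i) = 0)
    (hself : ∀ j < m, inner ℝ (d j) (z j) = ‖d j‖ ^ 2) (hnorm : ∀ j < m, ρ ≤ ‖d j‖) :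
    ∫⁻ u, ∏ j ∈ Finset.range m, ENNReal.ofReal (bump lam (inner ℝ (z j) u - θ j))
      ∂(gaussMeasure V T) ≤
      ENNReal.ofReal (2 * (1 + 1 / (T * ρ)) * √(Real.pi / (8 * lam))) ^ m := by
  have hmb : ∀ j, Measurable fun u : V => ENNReal.ofReal (bump lam (inner ℝ (z j) u - θ j)) :=
    fun j => ((continuous_bump lam).comp (by fun_prop)).measurable.ennreal_ofReal
  induction m with
  | zero =>
    have := isProbabilityMeasure_gaussMeasure (V := V) hT
    simp
  | succ m ih =>
    have ih' := ih (fun j hj => horth j (by omega)) (fun j hj => hself j (by omega))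
      (fun j hj => hnorm j (by omega))
    have hdm := hnorm m (Nat.lt_succ_self m)
    have hd : d m ≠ 0 := norm_pos_iff.mp (hρ.trans_le hdm)
    have hd0 : 0 < ‖d m‖ := hρ.trans_le hdm
    have hTd : 0 < T * ‖d m‖ := mul_pos hT hd0
    have := isProbabilityMeasure_gaussMeasure (V := V) hT
    have := isProbabilityMeasure_gaussMeasure (V := ℝ) hTd
    have hm : Measurable (fun p : V × ℝ =>
        p.1 + ((p.2 - inner ℝ (d m) p.1) / ‖d m‖ ^ 2) • d m) :=
      Continuous.measurable (by fun_prop)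
    have hmp : Measurable fun u : V => ∏ j ∈ Finset.range m,
        ENNReal.ofReal (bump lam (inner ℝ (z j) u - θ j)) :=
      Finset.measurable_prod _ fun j _ => hmb j
    have hmp' : Measurable fun u : V => ∏ j ∈ Finset.range (m + 1),
        ENNReal.ofReal (bump lam (inner ℝ (z j) u - θ j)) :=
      Finset.measurable_prod _ fun j _ => hmb j
    have hval : ∀ u : V, ∀ t : ℝ, ∏ j ∈ Finset.range (m + 1), ENNReal.ofReal (bump lam
        (inner ℝ (z j) (u + ((t - inner ℝ (d m) u) / ‖d m‖ ^ 2) • d m) - θ j)) =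
        (∏ j ∈ Finset.range m, ENNReal.ofReal (bump lam (inner ℝ (z j) u - θ j))) *
          ENNReal.ofReal (bump lam ((inner ℝ (z m) u - inner ℝ (d m) u - θ m) + t)) := by
      intro u t
      rw [Finset.prod_range_succ]
      congr 1
      · refine Finset.prod_congr rfl fun j hj => ?_
        rw [inner_add_right, inner_smul_right, real_inner_comm,
          real_inner_comm (d m) (z j), horth m (Nat.lt_succ_self m) j (Finset.mem_range.mp hj),
          mul_zero, add_zero, real_inner_comm]
      · congr 2
        rw [inner_add_right, inner_smul_right, real_inner_comm (d m) (z m),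
          hself m (Nat.lt_succ_self m), div_mul_cancel₀ _ (by positivity)]
        ring
    have hmc : Measurable fun p : V × ℝ => ∏ j ∈ Finset.range (m + 1), ENNReal.ofReal (bump lam
        (inner ℝ (z j) (p.1 + ((p.2 - inner ℝ (d m) p.1) / ‖d m‖ ^ 2) • d m) - θ j)) :=
      hmp'.comp hm
    rw [← map_resample_gaussMeasure hT hd, lintegral_map hmp' hm,
      lintegral_prod _ hmc.aemeasurable]
    simp only [hval]
    have hstep : ∀ u : V, ∫⁻ t, (∏ j ∈ Finset.range m,
        ENNReal.ofReal (bump lam (inner ℝ (z j) u - θ j))) *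
          ENNReal.ofReal (bump lam ((inner ℝ (z m) u - inner ℝ (d m) u - θ m) + t))
          ∂(gaussMeasure ℝ (T * ‖d m‖)) ≤
        (∏ j ∈ Finset.range m, ENNReal.ofReal (bump lam (inner ℝ (z j) u - θ j))) *
          ENNReal.ofReal (2 * (1 + 1 / (T * ρ)) * √(Real.pi / (8 * lam))) := by
      intro u
      have hmt : Measurable fun t : ℝ => ENNReal.ofReal
          (bump lam ((inner ℝ (z m) u - inner ℝ (d m) u - θ m) + t)) :=
        ((continuous_bump lam).comp (by fun_prop)).measurable.ennreal_ofReal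
      rw [lintegral_const_mul _ hmt]
      gcongr
      refine (lintegral_bump_gaussMeasure_le hlam hTd _).trans (ENNReal.ofReal_le_ofReal ?_)
      refine mul_le_mul_of_nonneg_right ((theta_sq_le hTd).trans ?_) (Real.sqrt_nonneg _)
      gcongr
    refine (lintegral_mono hstep).trans ?_
    rw [lintegral_mul_const _ hmp, pow_succ]
    gcongr

/-! ### Mollifying a dense piece of the discrete Gaussian -/

/-- The inclusion `ℤⁿ → ℝⁿ`. -/
noncomputable def latticePoint {n : ℕ} (x : Fin n → ℤ) : EuclideanSpace ℝ (Fin n) :=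
  WithLp.toLp 2 fun i => (x i : ℝ)

/-- The law of `x + y`, where `x ∈ ℤⁿ` has law `μ` and `y` is an independent Gaussian vector of
width `r`. -/
noncomputable def mollify {n : ℕ} (μ : PMF (Fin n → ℤ)) (r : ℝ) :
    Measure (EuclideanSpace ℝ (Fin n)) :=
  (μ.toMeasure.map latticePoint).conv (gaussMeasure _ r)

theorem pow_le_tsum_gaussianWeight (n : ℕ) {R : ℝ} (hR : 0 < R) :
    R ^ n ≤ ∑' x, gaussianWeight n R x := by
  have h1 : R ≤ ∑' k : ℤ, Real.exp (-Real.pi * (k : ℝ) ^ 2 / R ^ 2) := by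
    have h := theta_inv (a := R ^ 2) (by positivity)
    rw [Real.sqrt_sq hR.le] at h
    have h2 : theta (R ^ 2)⁻¹ = ∑' k : ℤ, Real.exp (-Real.pi * (k : ℝ) ^ 2 / R ^ 2) :=
      tsum_congr fun k => by congr 1; ring
    rw [← h2, h]
    exact le_mul_of_one_le_right hR.le (one_le_theta (by positivity))
  have hs : Summable fun k : ℤ => Real.exp (-Real.pi * (k : ℝ) ^ 2 / R ^ 2) := by
    simpa using summable_gaussian_shift (a := R ^ 2) (by positivity) 0
  have h3 := ennreal_tsum_prod (n := n) fun _ k =>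
    ENNReal.ofReal (Real.exp (-Real.pi * (k : ℝ) ^ 2 / R ^ 2))
  have h4 : ∀ x : Fin n → ℤ, ∏ i, ENNReal.ofReal (Real.exp (-Real.pi * (x i : ℝ) ^ 2 / R ^ 2)) =
      ENNReal.ofReal (gaussianWeight n R x) := by
    intro x
    rw [← ENNReal.ofReal_prod_of_nonneg fun i _ => (Real.exp_pos _).le, ← Real.exp_sum,
      gaussianWeight, Finset.mul_sum, Finset.sum_div]
  simp only [h4] at h3
  rw [← ENNReal.ofReal_tsum_of_nonneg (fun x => (gaussianWeight_pos n R x).le)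
    (summable_gaussianWeight n hR), ← ENNReal.ofReal_tsum_of_nonneg
    (fun k => (Real.exp_pos _).le) hs, Finset.prod_const, Finset.card_univ, Fintype.card_fin,
    ← ENNReal.ofReal_pow (hR.le.trans h1)] at h3
  rw [(ENNReal.ofReal_eq_ofReal_iff (tsum_nonneg fun x => (gaussianWeight_pos n R x).le)
    (pow_nonneg (hR.le.trans h1) n)).mp h3]
  gcongr

/-- Completing the square in the product of a lattice Gaussian weight and a shifted Gaussian. -/
theorem gaussianWeight_mul_gaussDensity {n : ℕ} {R r T : ℝ} (hR : 0 < R) (hr : 0 < r)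
    (hT : T ^ 2 = R ^ 2 + r ^ 2) (x : Fin n → ℤ) (u : EuclideanSpace ℝ (Fin n)) :
    gaussianWeight n R x * gaussDensity r (u - latticePoint x) =
      (r ^ n)⁻¹ * Real.exp (-Real.pi * ‖u‖ ^ 2 / T ^ 2) *
        ∏ i, Real.exp (-Real.pi * ((x i : ℝ) - R ^ 2 / T ^ 2 * u i) ^ 2 / (R * r / T) ^ 2) := by
  have hT2 : 0 < T ^ 2 := by rw [hT]; positivity
  have hT0 : T ≠ 0 := fun h => by simp [h] at hT2
  rw [gaussianWeight, gaussDensity, finrank_euclideanSpace_fin, ← Real.exp_sum, mul_left_comm,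
    mul_assoc, ← Real.exp_add, ← Real.exp_add]
  congr 2
  rw [EuclideanSpace.norm_sq_eq, EuclideanSpace.norm_sq_eq, Finset.mul_sum, Finset.mul_sum,
    Finset.mul_sum, Finset.sum_div, Finset.sum_div, Finset.sum_div, ← Finset.sum_add_distrib,
    ← Finset.sum_add_distrib]
  refine Finset.sum_congr rfl fun i _ => ?_
  rw [Real.norm_eq_abs, Real.norm_eq_abs, sq_abs, sq_abs]
  have : (u - latticePoint x) i = u i - x i := rfl
  rw [this, div_pow, mul_pow, hT]
  have h2 : R ^ 2 + r ^ 2 ≠ 0 := by positivity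
  field_simp
  ring

theorem tsum_discreteGaussian_mul_gaussDensity_le {n : ℕ} {R r T : ℝ} (hR : 0 < R) (hr : 0 < r)
    (hT0 : 0 < T) (hT : T ^ 2 = R ^ 2 + r ^ 2) (u : EuclideanSpace ℝ (Fin n)) :
    ∑' x, discreteGaussian n R hR x * ENNReal.ofReal (gaussDensity r (u - latticePoint x)) ≤
      ENNReal.ofReal (theta ((R * r / T) ^ 2) ^ n) * ENNReal.ofReal (gaussDensity T u) := by
  set Z := ∑' y, gaussianWeight n R y with hZ
  set s := R * r / T with hs
  have hs0 : 0 < s := by positivity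
  have hZR : R ^ n ≤ Z := pow_le_tsum_gaussianWeight n hR
  have hZ0 : 0 < Z := (pow_pos hR n).trans_le hZR
  have hterm : ∀ x, discreteGaussian n R hR x *
      ENNReal.ofReal (gaussDensity r (u - latticePoint x)) =
      ENNReal.ofReal (Z⁻¹ * ((r ^ n)⁻¹ * Real.exp (-Real.pi * ‖u‖ ^ 2 / T ^ 2))) *
        ∏ i, ENNReal.ofReal
          (Real.exp (-Real.pi * ((x i : ℝ) - R ^ 2 / T ^ 2 * u i) ^ 2 / s ^ 2)) := by
    intro x
    have h1 : discreteGaussian n R hR x = ENNReal.ofReal (gaussianWeight n R x / Z) := rfl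
    rw [h1, ← ENNReal.ofReal_mul (div_nonneg (gaussianWeight_pos n R x).le hZ0.le),
      ← ENNReal.ofReal_prod_of_nonneg fun i _ => (Real.exp_pos _).le,
      ← ENNReal.ofReal_mul (by positivity), div_eq_inv_mul, mul_assoc,
      gaussianWeight_mul_gaussDensity hR hr hT, mul_assoc Z⁻¹]
  simp only [hterm]
  rw [ENNReal.tsum_mul_left, ennreal_tsum_prod fun i k => ENNReal.ofReal
    (Real.exp (-Real.pi * ((k : ℝ) - R ^ 2 / T ^ 2 * u i) ^ 2 / s ^ 2))]
  have hfac : ∀ i : Fin n, ∑' k : ℤ, ENNReal.ofReal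
      (Real.exp (-Real.pi * ((k : ℝ) - R ^ 2 / T ^ 2 * u i) ^ 2 / s ^ 2)) ≤
      ENNReal.ofReal (s * theta (s ^ 2)) := by
    intro i
    rw [← ENNReal.ofReal_tsum_of_nonneg (fun k => (Real.exp_pos _).le)
      (summable_gaussian_shift (by positivity) _)]
    refine ENNReal.ofReal_le_ofReal ?_
    have := tsum_gaussian_shift_le (a := s ^ 2) (by positivity) (R ^ 2 / T ^ 2 * u i)
    rwa [Real.sqrt_sq hs0.le] at this
  have hθ : 0 < theta (s ^ 2) := zero_lt_one.trans_le (one_le_theta (by positivity))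
  refine (mul_le_mul_right (Finset.prod_le_prod' fun i _ => hfac i) _).trans ?_
  rw [Finset.prod_const, Finset.card_univ, Fintype.card_fin,
    ← ENNReal.ofReal_pow (by positivity), ← ENNReal.ofReal_mul (by positivity),
    ← ENNReal.ofReal_mul (by positivity)]
  refine ENNReal.ofReal_le_ofReal ?_
  rw [gaussDensity, finrank_euclideanSpace_fin]
  calc Z⁻¹ * ((r ^ n)⁻¹ * Real.exp (-Real.pi * ‖u‖ ^ 2 / T ^ 2)) * (s * theta (s ^ 2)) ^ n
      ≤ (R ^ n)⁻¹ * ((r ^ n)⁻¹ * Real.exp (-Real.pi * ‖u‖ ^ 2 / T ^ 2)) *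
          (s * theta (s ^ 2)) ^ n := by gcongr
    _ = _ := by
        rw [mul_pow, hs, div_pow, mul_pow]
        field_simp

theorem lintegral_mollify_le {n : ℕ} {R r T α : ℝ} (hR : 0 < R) (hr : 0 < r) (hT0 : 0 < T)
    (hT : T ^ 2 = R ^ 2 + r ^ 2) (hα : 0 < α) {μ : PMF (Fin n → ℤ)}
    (hμ : IsDensePiece α μ (discreteGaussian n R hR)) {F : EuclideanSpace ℝ (Fin n) → ℝ≥0∞}
    (hF : Measurable F) :
    ∫⁻ u, F u ∂(mollify μ r) ≤
      ENNReal.ofReal (α⁻¹ * theta ((R * r / T) ^ 2) ^ n) * ∫⁻ u, F u ∂(gaussMeasure _ T) := by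
  have := isProbabilityMeasure_gaussMeasure (V := EuclideanSpace ℝ (Fin n)) hr
  have hL : Measurable (latticePoint (n := n)) := measurable_of_countable _
  have hμ' : ∀ x, μ x ≤ ENNReal.ofReal α⁻¹ * discreteGaussian n R hR x := by
    intro x
    rw [← ENNReal.ofReal_toReal (μ.apply_ne_top x),
      ← ENNReal.ofReal_toReal ((discreteGaussian n R hR).apply_ne_top x),
      ← ENNReal.ofReal_mul (by positivity)]
    exact ENNReal.ofReal_le_ofReal (hμ x)
  have hshift : ∀ x : Fin n → ℤ, ∫⁻ y, F (latticePoint x + y) ∂(gaussMeasure _ r) =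
      ∫⁻ u, ENNReal.ofReal (gaussDensity r (u - latticePoint x)) * F u := by
    intro x
    have hFx : Measurable fun y => F (latticePoint x + y) := hF.comp (measurable_const_add _)
    rw [gaussMeasure, lintegral_withDensity_eq_lintegral_mul _ (measurable_gaussDensity r) hFx,
      ← lintegral_add_left_eq_self _ (-latticePoint x)]
    refine lintegral_congr fun u => ?_
    simp [sub_eq_neg_add]
  have hmx : ∀ x : Fin n → ℤ, Measurable fun u : EuclideanSpace ℝ (Fin n) =>
      ENNReal.ofReal (gaussDensity r (u - latticePoint x)) := fun x =>
    ((continuous_gaussDensity r).comp (by fun_prop)).measurable.ennreal_ofReal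
  have hmxF : ∀ x : Fin n → ℤ, Measurable fun u : EuclideanSpace ℝ (Fin n) =>
      ENNReal.ofReal (gaussDensity r (u - latticePoint x)) * F u := fun x => (hmx x).mul hF
  have hmxF' : ∀ x : Fin n → ℤ, Measurable fun u : EuclideanSpace ℝ (Fin n) =>
      discreteGaussian n R hR x * ENNReal.ofReal (gaussDensity r (u - latticePoint x)) * F u :=
    fun x => ((hmx x).const_mul _).mul hF
  have hTF : Measurable fun u : EuclideanSpace ℝ (Fin n) =>
      ENNReal.ofReal (gaussDensity T u) * F u := (measurable_gaussDensity T).mul hF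
  rw [mollify, Measure.lintegral_conv hF, lintegral_map
    (Measurable.lintegral_prod_right (by fun_prop)) hL, lintegral_countable']
  simp only [hshift, PMF.toMeasure_apply_singleton _ _ (MeasurableSet.singleton _)]
  calc ∑' x, (∫⁻ u, ENNReal.ofReal (gaussDensity r (u - latticePoint x)) * F u) * μ x
      ≤ ∑' x, (∫⁻ u, ENNReal.ofReal (gaussDensity r (u - latticePoint x)) * F u) *
          (ENNReal.ofReal α⁻¹ * discreteGaussian n R hR x) :=
        ENNReal.tsum_le_tsum fun x => by gcongr; exact hμ' x
    _ = ENNReal.ofReal α⁻¹ * ∫⁻ u, (∑' x, discreteGaussian n R hR x *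
          ENNReal.ofReal (gaussDensity r (u - latticePoint x))) * F u := by
        simp only [← ENNReal.tsum_mul_right]
        rw [lintegral_tsum fun x => (hmxF' x).aemeasurable, ← ENNReal.tsum_mul_left]
        refine tsum_congr fun x => ?_
        simp only [mul_assoc]
        rw [lintegral_const_mul _ (hmxF x), mul_comm, mul_assoc]
    _ ≤ ENNReal.ofReal α⁻¹ * ∫⁻ u, (ENNReal.ofReal (theta ((R * r / T) ^ 2) ^ n) *
          ENNReal.ofReal (gaussDensity T u)) * F u := by
        gcongr with u
        exact tsum_discreteGaussian_mul_gaussDensity_le hR hr hT0 hT u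
    _ = _ := by
        simp only [mul_assoc]
        rw [lintegral_const_mul _ hTF, gaussMeasure,
          lintegral_withDensity_eq_lintegral_mul _ (measurable_gaussDensity T) hF,
          ENNReal.ofReal_mul (by positivity), mul_assoc]
        rfl

/-! ### Large Fourier coefficients and Jensen's inequality -/

section Jensen

variable {V : Type*} [NormedAddCommGroup V] [InnerProductSpace ℝ V]
  [MeasurableSpace V] [BorelSpace V]

theorem exists_phase_of_le_norm_charFun {ν : Measure V} [IsProbabilityMeasure ν] {z : V} {δ : ℝ}
    (h : 1 - δ ≤ ‖charFun ν ((2 * Real.pi) • z)‖) :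
    ∃ θ : ℝ, ∫ u, (1 - Real.cos (2 * Real.pi * (inner ℝ z u - θ))) ∂ν ≤ δ := by
  set c := charFun ν ((2 * Real.pi) • z) with hc
  refine ⟨c.arg / (2 * Real.pi), ?_⟩
  have hcos : ∀ u : V, Real.cos (2 * Real.pi * (inner ℝ z u - c.arg / (2 * Real.pi))) =
      RCLike.re (Complex.exp ((inner ℝ u ((2 * Real.pi) • z) : ℝ) * Complex.I) *
        Complex.exp (-(c.arg : ℂ) * Complex.I)) := by
    intro u
    rw [← Complex.exp_add, ← add_mul, ← Complex.ofReal_neg, ← Complex.ofReal_add]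
    rw [show ∀ w : ℂ, RCLike.re w = w.re from fun _ => rfl, Complex.exp_ofReal_mul_I_re]
    congr 1
    rw [inner_smul_right, real_inner_comm, mul_sub,
      mul_div_cancel₀ _ Real.two_pi_pos.ne', sub_eq_add_neg]
  have hint : Integrable (fun u : V => Complex.exp ((inner ℝ u ((2 * Real.pi) • z) : ℝ) *
      Complex.I) * Complex.exp (-(c.arg : ℂ) * Complex.I)) ν := by
    refine Integrable.of_bound (C := 1) (Continuous.aestronglyMeasurable (by fun_prop))
      (ae_of_all _ fun u => ?_)
    rw [norm_mul, Complex.norm_exp_ofReal_mul_I, one_mul, ← Complex.ofReal_neg,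
      Complex.norm_exp_ofReal_mul_I]
  have hre : Integrable (fun u : V =>
      Real.cos (2 * Real.pi * (inner ℝ z u - c.arg / (2 * Real.pi)))) ν := by
    simp only [hcos]
    exact hint.re
  have hval : ∫ u, Real.cos (2 * Real.pi * (inner ℝ z u - c.arg / (2 * Real.pi))) ∂ν = ‖c‖ := by
    simp only [hcos]
    rw [integral_re hint, integral_mul_const, ← charFun_apply, ← hc]
    nth_rewrite 1 [← Complex.norm_mul_exp_arg_mul_I c]
    rw [mul_assoc, ← Complex.exp_add, neg_mul, add_neg_cancel, Complex.exp_zero, mul_one]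
    exact Complex.ofReal_re _
  rw [integral_sub (integrable_const _) hre, hval]
  simp
  linarith

/-- Jensen's inequality for the product of the bumps centered at the phases of large Fourier
coefficients. -/
theorem exists_phases_le_lintegral_prod_bump {ν : Measure V} [IsProbabilityMeasure ν]
    {lam δ : ℝ} (hlam : 0 < lam) (z : ℕ → V) (m : ℕ)
    (h : ∀ j < m, 1 - δ ≤ ‖charFun ν ((2 * Real.pi) • z j)‖) :
    ∃ θ : ℕ → ℝ, ENNReal.ofReal (Real.exp (-(lam * (m * δ)))) ≤
      ∫⁻ u, ∏ j ∈ Finset.range m, ENNReal.ofReal (bump lam (inner ℝ (z j) u - θ j)) ∂ν := by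
  have h' : ∀ j, ∃ θ : ℝ, j < m →
      ∫ u, (1 - Real.cos (2 * Real.pi * (inner ℝ (z j) u - θ))) ∂ν ≤ δ := fun j => by
    by_cases hj : j < m
    · obtain ⟨θ, hθ⟩ := exists_phase_of_le_norm_charFun (h j hj)
      exact ⟨θ, fun _ => hθ⟩
    · exact ⟨0, fun hj' => absurd hj' hj⟩
  choose θ hθ using h'
  refine ⟨θ, ?_⟩
  have hc : ∀ j, Integrable
      (fun u => 1 - Real.cos (2 * Real.pi * (inner ℝ (z j) u - θ j))) ν := by
    intro j
    refine Integrable.of_bound (C := 2) (Continuous.aestronglyMeasurable (by fun_prop))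
      (ae_of_all _ fun u => ?_)
    rw [Real.norm_eq_abs, abs_le]
    constructor <;>
    linarith [Real.neg_one_le_cos (2 * Real.pi * (inner ℝ (z j) u - θ j)),
      Real.cos_le_one (2 * Real.pi * (inner ℝ (z j) u - θ j))]
  set X : V → ℝ := fun u =>
    ∑ j ∈ Finset.range m, (1 - Real.cos (2 * Real.pi * (inner ℝ (z j) u - θ j))) with hX
  have hXi : Integrable X ν := integrable_finsetSum _ fun j _ => hc j
  have hX0 : ∀ u, 0 ≤ X u := fun u => Finset.sum_nonneg fun j _ => by
    linarith [Real.cos_le_one (2 * Real.pi * (inner ℝ (z j) u - θ j))]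
  have hXle : ∫ u, X u ∂ν ≤ m * δ := by
    rw [hX, integral_finsetSum _ fun j _ => hc j]
    refine (Finset.sum_le_sum fun j hj => hθ j (Finset.mem_range.mp hj)).trans ?_
    simp
  have hprod : ∀ u, ∏ j ∈ Finset.range m, ENNReal.ofReal (bump lam (inner ℝ (z j) u - θ j)) =
      ENNReal.ofReal (Real.exp (-lam * X u)) := by
    intro u
    rw [← ENNReal.ofReal_prod_of_nonneg fun j _ => (bump_pos _ _).le]
    simp only [bump]
    rw [← Real.exp_sum, hX, Finset.mul_sum]
  have hXc : Continuous X := by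
    rw [hX]
    fun_prop
  have hei : Integrable (fun u => Real.exp (-lam * X u)) ν := by
    refine Integrable.of_bound (C := 1) (Continuous.aestronglyMeasurable (by fun_prop))
      (ae_of_all _ fun u => ?_)
    rw [Real.norm_of_nonneg (Real.exp_pos _).le, Real.exp_le_one_iff]
    nlinarith [hX0 u]
  simp only [hprod]
  rw [← ofReal_integral_eq_lintegral_ofReal hei (ae_of_all _ fun u => (Real.exp_pos _).le)]
  refine ENNReal.ofReal_le_ofReal ?_
  set a := -(lam * (m * δ)) with ha
  -- the tangent line of `exp` at `a`
  have htan : ∀ u, Real.exp a * (1 - a) + (-(Real.exp a * lam)) * X u ≤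
      Real.exp (-lam * X u) := by
    intro u
    have h1 := Real.add_one_le_exp (-lam * X u - a)
    have h2 : Real.exp (-lam * X u) = Real.exp a * Real.exp (-lam * X u - a) := by
      rw [← Real.exp_add]
      congr 1
      ring
    rw [h2]
    nlinarith [Real.exp_pos a]
  have hmono := integral_mono ((integrable_const (Real.exp a * (1 - a))).add
    (hXi.const_mul (-(Real.exp a * lam)))) hei htan
  refine le_trans ?_ hmono
  simp only [Pi.add_apply]
  rw [integral_add (integrable_const _) (hXi.const_mul _), integral_const,
    integral_const_mul (-(Real.exp a * lam)) X]
  simp only [probReal_univ, one_smul]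
  have h3 : Real.exp a * lam * ∫ u, X u ∂ν ≤ Real.exp a * lam * (m * δ) := by
    gcongr
  have h4 : Real.exp a * lam * (m * δ) = -(Real.exp a * a) := by rw [ha]; ring
  linarith

end Jensen

theorem norm_charFun_map_latticePoint {n : ℕ} (μ : PMF (Fin n → ℤ))
    (z : EuclideanSpace ℝ (Fin n)) :
    ‖charFun (μ.toMeasure.map latticePoint) ((2 * Real.pi) • z)‖ =
      ‖fourierTransform μ (toTorus z)‖ := by
  have hL : Measurable (latticePoint (n := n)) := measurable_of_countable _
  have hconj : ‖charFun (μ.toMeasure.map latticePoint) ((2 * Real.pi) • z)‖ =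
      ‖charFun (μ.toMeasure.map latticePoint) (-((2 * Real.pi) • z))‖ := by
    rw [charFun_neg, RCLike.norm_conj]
  rw [hconj, charFun_apply, integral_map hL.aemeasurable
    (Continuous.aestronglyMeasurable (by fun_prop)), PMF.integral_eq_tsum, fourierTransform]
  · congr 1
    refine tsum_congr fun x => ?_
    rw [Complex.real_smul]
    congr 1
    have hp : -pairing (toTorus z) x = ((-(∑ i, (x i : ℝ) * z i) : ℝ) : UnitAddCircle) := by
      rw [pairing, toTorus, AddCircle.coe_neg]
      congr 1
      rw [← QuotientAddGroup.mk'_apply, map_sum]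
      refine Finset.sum_congr rfl fun i _ => ?_
      rw [← zsmul_eq_mul, map_zsmul]
      rfl
    rw [hp, AddCircle.toCircle_apply_mk, Circle.coe_exp]
    congr 2
    have : inner ℝ (latticePoint x) (-((2 * Real.pi) • z)) =
        -(2 * Real.pi * ∑ i, (x i : ℝ) * z i) := by
      rw [inner_neg_right, inner_smul_right, PiLp.inner_apply]
      congr 2
      refine Finset.sum_congr rfl fun i _ => ?_
      simp [latticePoint, mul_comm]
    rw [this]
    push_cast
    ring
  · refine Integrable.of_bound (C := 1) (measurable_of_countable _).aestronglyMeasurable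
      (ae_of_all _ fun u => ?_)
    rw [Complex.norm_exp_ofReal_mul_I]

theorem isProbabilityMeasure_mollify {n : ℕ} (μ : PMF (Fin n → ℤ)) {r : ℝ} (hr : 0 < r) :
    IsProbabilityMeasure (mollify μ r) := by
  have hL : Measurable (latticePoint (n := n)) := measurable_of_countable _
  have := isProbabilityMeasure_gaussMeasure (V := EuclideanSpace ℝ (Fin n)) hr
  have := Measure.isProbabilityMeasure_map (μ := μ.toMeasure) hL.aemeasurable
  unfold mollify
  infer_instance

/-- Near the origin, mollification damps the Fourier transform only slightly. -/
theorem le_norm_charFun_mollify {n : ℕ} (μ : PMF (Fin n → ℤ)) {r ε : ℝ} (hr : 0 < r)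
    {z : EuclideanSpace ℝ (Fin n)} (hz : 1 - ε ≤ ‖fourierTransform μ (toTorus z)‖) :
    1 - (ε + Real.pi * r ^ 2 * ‖z‖ ^ 2) ≤ ‖charFun (mollify μ r) ((2 * Real.pi) • z)‖ := by
  have hL : Measurable (latticePoint (n := n)) := measurable_of_countable _
  have := isProbabilityMeasure_gaussMeasure (V := EuclideanSpace ℝ (Fin n)) hr
  have := Measure.isProbabilityMeasure_map (μ := μ.toMeasure) hL.aemeasurable
  rw [mollify, charFun_conv, norm_mul, charFun_gaussMeasure hr, Complex.norm_real,
    Real.norm_of_nonneg (Real.exp_pos _).le]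
  have hle := norm_charFun_le_one (μ := μ.toMeasure.map latticePoint) (t := (2 * Real.pi) • z)
  rw [norm_charFun_map_latticePoint] at hle ⊢
  have hexp : -(r ^ 2 * ‖(2 * Real.pi) • z‖ ^ 2 / (4 * Real.pi)) =
      -(Real.pi * r ^ 2 * ‖z‖ ^ 2) := by
    rw [norm_smul, mul_pow, Real.norm_eq_abs, sq_abs]
    field_simp
    ring
  rw [hexp]
  have h1 := Real.add_one_le_exp (-(Real.pi * r ^ 2 * ‖z‖ ^ 2))
  have h2 : Real.exp (-(Real.pi * r ^ 2 * ‖z‖ ^ 2)) ≤ 1 := by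
    rw [Real.exp_le_one_iff, neg_nonpos]
    positivity
  nlinarith [mul_nonneg (sub_nonneg.mpr hle) (sub_nonneg.mpr h2)]

/-! ### Counting independent frequencies -/

/-- The smoothing estimate: `exp (-πs²) ≤ 1 / (8n)` makes the `n`-fold product of theta sums
bounded. -/
theorem theta_pow_le_two {n : ℕ} (hn : 1 ≤ n) {a : ℝ} (ha : Real.log (8 * n) / Real.pi ≤ a) :
    theta a ^ n ≤ 2 := by
  have hn' : (1 : ℝ) ≤ n := by exact_mod_cast hn
  have hlog : 0 < Real.log (8 * n) := Real.log_pos (by linarith)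
  have ha0 : 0 < a := (div_pos hlog Real.pi_pos).trans_le ha
  have hq : Real.exp (-Real.pi * a) ≤ 1 / (8 * n) := by
    rw [one_div, ← Real.exp_log (show (0 : ℝ) < 8 * n by linarith), ← Real.exp_neg]
    refine Real.exp_le_exp.mpr ?_
    rw [div_le_iff₀ Real.pi_pos] at ha
    linarith
  have hq1 : 1 / (8 * (n : ℝ)) < 1 := by
    rw [div_lt_one (by linarith)]
    linarith
  have h := theta_le_of_exp_le ha0 hq hq1
  have h2 : 2 * (1 / (8 * (n : ℝ))) / (1 - 1 / (8 * n)) ≤ 1 / (2 * n) := by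
    have h8 : (0 : ℝ) < 8 * n - 1 := by linarith
    have : 2 * (1 / (8 * (n : ℝ))) / (1 - 1 / (8 * n)) = 2 / (8 * n - 1) := by
      field_simp
    rw [this, div_le_div_iff₀ h8 (by linarith)]
    linarith
  have hθ : 0 ≤ theta a := zero_le_one.trans (one_le_theta ha0)
  calc theta a ^ n ≤ Real.exp (1 / (2 * n)) ^ n := by
        refine pow_le_pow_left₀ hθ ?_ n
        linarith [Real.add_one_le_exp (1 / (2 * (n : ℝ)))]
    _ = Real.exp (1 / 2) := by
        rw [← Real.exp_nat_mul]
        congr 1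
        field_simp
    _ ≤ Real.exp (Real.log 2) := Real.exp_le_exp.mpr (by linarith [Real.log_two_gt_d9])
    _ = 2 := Real.exp_log two_pos

/-- The gain per frequency under the dominating Gaussian, for bumps of sharpness `K / 8`, beats
the loss `exp (7 / 4)` per frequency in Jensen's inequality by a factor `2 * B`. -/
theorem factor_mul_exp_le {B K T ρ : ℝ} (hB : 1 ≤ B) (hK : 200 * B ≤ √K)
    (hTρ : 300 * B / √K ≤ T * ρ) :
    2 * (1 + 1 / (T * ρ)) * √(Real.pi / (8 * (K / 8))) * Real.exp (7 / 4) ≤ (2 * B)⁻¹ := by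
  have hK0 : 0 < √K := by linarith
  have h1 : √(Real.pi / (8 * (K / 8))) ≤ 9 / 5 / √K := by
    rw [mul_div_cancel₀ _ (by norm_num : (8 : ℝ) ≠ 0), Real.sqrt_div Real.pi_pos.le]
    gcongr
    rw [Real.sqrt_le_left (by norm_num)]
    linarith [Real.pi_lt_d2]
  have h2 : 1 / (T * ρ) ≤ √K / (300 * B) := by
    have := one_div_le_one_div_of_le (by positivity) hTρ
    rwa [one_div_div] at this
  have h3 : Real.exp (7 / 4) ≤ 8 := by
    calc Real.exp (7 / 4) ≤ Real.exp (Real.log 8) := by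
          refine Real.exp_le_exp.mpr ?_
          rw [show (8 : ℝ) = 2 ^ 3 by norm_num, Real.log_pow]
          push_cast
          linarith [Real.log_two_gt_d9]
      _ = 8 := Real.exp_log (by norm_num)
  have h4 : 1 / √K ≤ 1 / (200 * B) := one_div_le_one_div_of_le (by positivity) hK
  calc 2 * (1 + 1 / (T * ρ)) * √(Real.pi / (8 * (K / 8))) * Real.exp (7 / 4)
      ≤ 2 * (1 + √K / (300 * B)) * (9 / 5 / √K) * 8 := by gcongr
    _ = 144 / 5 * (1 / √K + 1 / (300 * B)) := by field_simp; ring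
    _ ≤ 144 / 5 * (1 / (200 * B) + 1 / (300 * B)) := by gcongr
    _ = 6 / 25 * B⁻¹ := by field_simp; norm_num
    _ ≤ (2 * B)⁻¹ := by
        rw [mul_inv]
        have : 0 < B⁻¹ := by positivity
        linarith

/-- There are few frequencies in the near-origin large spectrum which are each far from the span of
their predecessors: the mean of the product of their bumps is at least `exp (-7 / 4) ^ m` under the mollified
dense piece and exponentially smaller under the Gaussian dominating it. -/
theorem two_mul_pow_le {n : ℕ} (hn : 1 ≤ n) {R K α κ B ρ : ℝ} (hR : 2 ≤ R)
    (hα : 0 < α) (hκ : 0 < κ) (hB : 1 ≤ B) (hρ : 0 < ρ) {μ : PMF (Fin n → ℤ)}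
    (hμ : IsDensePiece α μ (discreteGaussian n R (lt_of_lt_of_le two_pos hR)))
    (hκR : 3 ≤ κ * R) (hκK : κ ^ 2 * (K * Real.log (8 * n)) ≤ 2 * Real.pi)
    (hBK : 200 * B ≤ √K) (hRρ : 300 * B / √K ≤ R * ρ)
    (z d : ℕ → EuclideanSpace ℝ (Fin n)) (m : ℕ)
    (hz : ∀ j < m, 1 - 1 / K ≤ ‖fourierTransform μ (toTorus (z j))‖ ∧ ‖z j‖ ≤ κ)
    (horth : ∀ j < m, ∀ i < j, inner ℝ (d j) (z i) = 0)
    (hself : ∀ j < m, inner ℝ (d j) (z j) = ‖d j‖ ^ 2) (hnorm : ∀ j < m, ρ ≤ ‖d j‖) :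
    (2 * B) ^ m ≤ 2 / α := by
  have hR0 : 0 < R := by linarith
  have hn' : (1 : ℝ) ≤ n := by exact_mod_cast hn
  have hK0 : 0 < K := Real.sqrt_pos.mp (by linarith)
  have hK1 : 1 ≤ K := by
    by_contra! h
    have := Real.sqrt_le_one.mpr h.le
    linarith
  set L := Real.log (8 * n) with hL
  have hL0 : 0 < L := Real.log_pos (by linarith)
  -- the width of the mollifier is a constant multiple of the smoothing parameter of `ℤⁿ`
  set r := √(2 * L / Real.pi) with hr
  have hr2 : r ^ 2 = 2 * L / Real.pi := Real.sq_sqrt (by positivity)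
  have hr0 : 0 < r := Real.sqrt_pos.mpr (by positivity)
  set T := √(R ^ 2 + r ^ 2) with hTdef
  have hT2 : T ^ 2 = R ^ 2 + r ^ 2 := Real.sq_sqrt (by positivity)
  have hT0 : 0 < T := Real.sqrt_pos.mpr (by positivity)
  have hTR : R ≤ T := by
    rw [hTdef]
    exact Real.le_sqrt_of_sq_le (by nlinarith)
  have hrR : r ^ 2 ≤ R ^ 2 := by
    have hL' : κ ^ 2 * L ≤ 2 * Real.pi := by
      refine le_trans ?_ hκK
      gcongr
      exact le_mul_of_one_le_left hL0.le hK1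
    have h9 : 9 ≤ κ ^ 2 * R ^ 2 := by nlinarith
    have : κ ^ 2 * r ^ 2 ≤ κ ^ 2 * R ^ 2 := by
      refine le_trans ?_ h9
      rw [hr2, ← mul_div_assoc, div_le_iff₀ Real.pi_pos]
      linarith [Real.pi_pos]
    exact le_of_mul_le_mul_left this (by positivity)
  have hs : L / Real.pi ≤ (R * r / T) ^ 2 := by
    have : L / Real.pi = r ^ 2 / 2 := by rw [hr2]; ring
    rw [this, div_pow, mul_pow, hT2, div_le_div_iff₀ two_pos (by positivity)]
    nlinarith [sq_nonneg r]
  have hθ := theta_pow_le_two hn hs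
  have := isProbabilityMeasure_mollify μ hr0
  -- `1 + 4π ≤ 14`
  have hfour : ∀ j < m, 1 - 14 / K ≤ ‖charFun (mollify μ r) ((2 * Real.pi) • z j)‖ := by
    intro j hj
    refine le_trans ?_ (le_norm_charFun_mollify μ hr0 (hz j hj).1)
    have h1 : Real.pi * r ^ 2 * ‖z j‖ ^ 2 ≤ 13 / K := by
      have h2 : ‖z j‖ ^ 2 ≤ κ ^ 2 := by gcongr; exact (hz j hj).2
      have h3 : Real.pi * r ^ 2 = 2 * L := by rw [hr2]; field_simp
      rw [h3, le_div_iff₀ hK0]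
      nlinarith [mul_le_mul_of_nonneg_left h2 (mul_pos hL0 hK0).le, Real.pi_lt_d2]
    have h4 : 14 / K = 1 / K + 13 / K := by ring
    linarith
  -- sharpness of order `K` balances the loss in Jensen's inequality against the width of the bumps
  obtain ⟨θ, hJ⟩ := exists_phases_le_lintegral_prod_bump (lam := K / 8) (by positivity) z m hfour
  have hF : Measurable fun u => ∏ j ∈ Finset.range m,
      ENNReal.ofReal (bump (K / 8) (inner ℝ (z j) u - θ j)) :=
    Finset.measurable_prod _ fun j _ =>
      ((continuous_bump (K / 8)).comp (by fun_prop)).measurable.ennreal_ofReal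
  have hup := lintegral_mollify_le hR0 hr0 hT0 hT2 hα hμ hF
  have hind := lintegral_prod_bump_le hT0 hρ (lam := K / 8) (by positivity) z d θ m horth hself
    hnorm
  set p := 2 * (1 + 1 / (T * ρ)) * √(Real.pi / (8 * (K / 8))) with hp
  have hp0 : 0 ≤ p := by positivity
  have hpB : p * Real.exp (7 / 4) ≤ (2 * B)⁻¹ := factor_mul_exp_le hB hBK
    (hRρ.trans (by gcongr))
  clear_value p
  have hθ0 : 0 ≤ theta ((R * r / T) ^ 2) :=
    zero_le_one.trans (one_le_theta (by positivity))
  have hfin := hJ.trans (hup.trans (mul_le_mul_right hind _))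
  rw [← ENNReal.ofReal_pow hp0, ← ENNReal.ofReal_mul (by positivity),
    ENNReal.ofReal_le_ofReal_iff (by positivity)] at hfin
  have hexp : Real.exp (-(K / 8 * (m * (14 / K)))) * Real.exp (7 / 4) ^ m = 1 := by
    rw [← Real.exp_nat_mul, ← Real.exp_add, Real.exp_eq_one_iff]
    field_simp
    ring
  have h1 : 1 ≤ 2 / α * (2 * B)⁻¹ ^ m := by
    calc 1 = Real.exp (-(K / 8 * (m * (14 / K)))) * Real.exp (7 / 4) ^ m := hexp.symm
      _ ≤ α⁻¹ * theta ((R * r / T) ^ 2) ^ n * p ^ m * Real.exp (7 / 4) ^ m := by gcongr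
      _ = α⁻¹ * theta ((R * r / T) ^ 2) ^ n * (p * Real.exp (7 / 4)) ^ m := by
          rw [mul_pow]; ring
      _ ≤ α⁻¹ * 2 * (2 * B)⁻¹ ^ m := by gcongr
      _ = _ := by ring
  rw [inv_pow, ← div_eq_mul_inv, le_div_iff₀ (by positivity), one_mul] at h1
  exact h1

/-! ### Greedy bases and rounding to the grid -/

section Greedy

variable {V : Type*} [NormedAddCommGroup V] [InnerProductSpace ℝ V]

open Classical in
/-- The span of `z 0, …, z (j - 1)`. -/
noncomputable def prefixSpan (z : ℕ → V) (j : ℕ) : Submodule ℝ V :=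
  Submodule.span ℝ ((Finset.range j).image z : Set V)

theorem mem_prefixSpan (z : ℕ → V) {i j : ℕ} (h : i < j) : z i ∈ prefixSpan z j := by
  classical
  exact Submodule.subset_span (by simpa using ⟨i, h, rfl⟩)

theorem prefixSpan_congr {z w : ℕ → V} {j : ℕ} (h : ∀ i < j, z i = w i) :
    prefixSpan z j = prefixSpan w j := by
  classical
  rw [prefixSpan, prefixSpan, Finset.image_congr fun i hi => h i (by simpa using hi)]

theorem finrank_prefixSpan_le (z : ℕ → V) (j : ℕ) :
    Module.finrank ℝ (prefixSpan z j) ≤ j := by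
  classical
  exact (finrank_span_finset_le_card _).trans (Finset.card_image_le.trans (by simp))

variable [FiniteDimensional ℝ V]

/-- The residual of `z j` after projecting onto the span of its predecessors. -/
noncomputable def residual (z : ℕ → V) (j : ℕ) : V :=
  z j - (prefixSpan z j).starProjection (z j)

theorem inner_residual_of_lt (z : ℕ → V) {i j : ℕ} (h : i < j) :
    inner ℝ (residual z j) (z i) = 0 :=
  Submodule.starProjection_inner_eq_zero _ _ (mem_prefixSpan z h)

theorem inner_residual_self (z : ℕ → V) (j : ℕ) :
    inner ℝ (residual z j) (z j) = ‖residual z j‖ ^ 2 := by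
  have h : inner ℝ (residual z j) ((prefixSpan z j).starProjection (z j)) = 0 :=
    Submodule.starProjection_inner_eq_zero _ _ (Submodule.starProjection_apply_mem _ _)
  rw [← real_inner_self_eq_norm_sq]
  nth_rewrite 3 [residual]
  rw [inner_sub_right, h, sub_zero]

/-- Picking greedily elements of `Z` far from the span of the previous ones, if this can go on for
at most `N` steps, ends with a span to which all of `Z` is close. -/
theorem exists_prefixSpan_close {Z : Set V} {ρ N : ℝ}
    (hN : ∀ (z : ℕ → V) (m : ℕ), (∀ j < m, z j ∈ Z ∧ ρ < ‖residual z j‖) → (m : ℝ) ≤ N) :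
    ∃ (z : ℕ → V) (m : ℕ), (m : ℝ) ≤ N ∧
      ∀ v ∈ Z, ‖v - (prefixSpan z m).starProjection v‖ ≤ ρ := by
  by_contra! hcon
  have hall : ∀ m : ℕ, ∃ z : ℕ → V, ∀ j < m, z j ∈ Z ∧ ρ < ‖residual z j‖ := by
    intro m
    induction m with
    | zero => exact ⟨0, fun j hj => absurd hj (Nat.not_lt_zero j)⟩
    | succ m ih =>
      obtain ⟨z, hz⟩ := ih
      obtain ⟨v, hv, hvρ⟩ := hcon z m (hN z m hz)
      have hne : ∀ i < m, Function.update z m v i = z i := fun i hi =>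
        Function.update_of_ne hi.ne _ _
      refine ⟨Function.update z m v, fun j hj => ?_⟩
      rcases Nat.lt_succ_iff_lt_or_eq.mp hj with h | rfl
      · simp only [residual, prefixSpan_congr fun i hi => hne i (hi.trans h), hne j h]
        exact hz j h
      · simp only [residual, prefixSpan_congr hne, Function.update_self]
        exact ⟨hv, hvρ⟩
  obtain ⟨z, hz⟩ := hall (⌊N⌋₊ + 1)
  have := hN z _ hz
  push_cast at this
  linarith [Nat.lt_floor_add_one N]

end Greedy

/-- Rounding towards zero, strictly so at positive numbers, stays in the half-open interval. -/
theorem exists_grid_coord {Q : ℝ} (hQ : 0 < Q) {t : ℝ} (ht : |t| ≤ 1 / 2) :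
    ∃ k : ℤ, |t - Q⁻¹ * k| ≤ Q⁻¹ ∧ -(1 / 2) ≤ Q⁻¹ * k ∧ Q⁻¹ * k < 1 / 2 := by
  have hQi : 0 < Q⁻¹ := inv_pos.mpr hQ
  rw [abs_le] at ht
  have ht' : t = Q⁻¹ * (t * Q) := by field_simp
  have h1 := mul_le_mul_of_nonneg_left (Int.le_ceil (t * Q)) hQi.le
  have h2 := mul_lt_mul_of_pos_left (Int.ceil_lt_add_one (t * Q)) hQi
  rw [← ht'] at h1
  rw [mul_add, ← ht', mul_one] at h2
  rcases lt_or_ge 0 t with h | h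
  · refine ⟨⌈t * Q⌉ - 1, ?_⟩
    have h3 : 0 ≤ Q⁻¹ * ((⌈t * Q⌉ - 1 : ℤ) : ℝ) := by
      refine mul_nonneg hQi.le ?_
      have : 0 < ⌈t * Q⌉ := Int.ceil_pos.mpr (mul_pos h hQ)
      exact_mod_cast (by omega : (0 : ℤ) ≤ ⌈t * Q⌉ - 1)
    push_cast at h3 ⊢
    rw [mul_sub, mul_one] at h3 ⊢
    exact ⟨abs_le.mpr ⟨by linarith, by linarith⟩, by linarith, by linarith⟩
  · refine ⟨⌈t * Q⌉, ?_⟩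
    have h3 : Q⁻¹ * (⌈t * Q⌉ : ℝ) ≤ 0 := by
      refine mul_nonpos_of_nonneg_of_nonpos hQi.le ?_
      have : ⌈t * Q⌉ ≤ 0 := Int.ceil_le.mpr (by simpa using mul_nonpos_of_nonpos_of_nonneg h hQ.le)
      exact_mod_cast this
    exact ⟨abs_le.mpr ⟨by linarith, by linarith⟩, by linarith, by linarith⟩

theorem exists_boundedGrid_close {n : ℕ} {Q : ℝ} (hQ : 0 < Q) {b : EuclideanSpace ℝ (Fin n)}
    (hb : ‖b‖ ≤ 1) : ∃ η ∈ boundedGrid n Q, ‖(1 / 2 : ℝ) • b - η‖ ≤ √n * Q⁻¹ := by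
  have hcoord : ∀ i, |((1 / 2 : ℝ) • b) i| ≤ 1 / 2 := by
    intro i
    have := (PiLp.norm_apply_le b i).trans hb
    rw [Real.norm_eq_abs] at this
    rw [PiLp.smul_apply, smul_eq_mul, abs_mul, abs_of_pos (by norm_num : (0 : ℝ) < 1 / 2)]
    linarith
  choose k hk using fun i => exists_grid_coord hQ (hcoord i)
  refine ⟨WithLp.toLp 2 fun i => Q⁻¹ * (k i : ℝ), ⟨⟨k, fun i => rfl⟩, fun i => (hk i).2⟩, ?_⟩
  rw [EuclideanSpace.norm_eq]
  have hQi : 0 < Q⁻¹ := inv_pos.mpr hQ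
  calc √(∑ i, ‖((1 / 2 : ℝ) • b - WithLp.toLp 2 fun i => Q⁻¹ * (k i : ℝ)) i‖ ^ 2)
      ≤ √(∑ _i : Fin n, Q⁻¹ ^ 2) := by
        refine Real.sqrt_le_sqrt (Finset.sum_le_sum fun i _ => ?_)
        exact pow_le_pow_left₀ (norm_nonneg _) (hk i).1 2
    _ = √n * Q⁻¹ := by
        rw [Finset.sum_const, Finset.card_univ, Fintype.card_fin, nsmul_eq_mul,
          Real.sqrt_mul (Nat.cast_nonneg n), Real.sqrt_sq hQi.le]

/-- A subspace is approximated by the span of grid points: round half of each vector of an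
orthonormal basis. -/
theorem exists_boundedGrid_span_close {n : ℕ} {Q : ℝ} (hQ : 0 < Q)
    (W : Submodule ℝ (EuclideanSpace ℝ (Fin n))) :
    ∃ η : Fin (Module.finrank ℝ W) → EuclideanSpace ℝ (Fin n), (∀ i, η i ∈ boundedGrid n Q) ∧
      ∀ w ∈ W, ∃ v ∈ Submodule.span ℝ (Set.range η),
        ‖w - v‖ ≤ 2 * ‖w‖ * √(Module.finrank ℝ W) * (√n * Q⁻¹) := by
  let b := stdOrthonormalBasis ℝ W
  have hb : ∀ i, ‖((b i : W) : EuclideanSpace ℝ (Fin n))‖ ≤ 1 := fun i =>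
    (b.norm_eq_one i).le
  choose η hη hηb using fun i => exists_boundedGrid_close hQ (hb i)
  refine ⟨η, hη, fun w hw => ?_⟩
  set c : Fin (Module.finrank ℝ W) → ℝ := fun i => inner ℝ (b i) (⟨w, hw⟩ : W) with hc
  refine ⟨∑ i, (2 * c i) • η i, Submodule.sum_mem _ fun i _ =>
    Submodule.smul_mem _ _ (Submodule.subset_span ⟨i, rfl⟩), ?_⟩
  have hw' : w = ∑ i, c i • ((b i : W) : EuclideanSpace ℝ (Fin n)) := by
    have := congrArg (Submodule.subtype W) (b.sum_repr' (⟨w, hw⟩ : W))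
    rw [map_sum] at this
    simpa [hc] using this.symm
  have hdiff : w - ∑ i, (2 * c i) • η i =
      ∑ i, (2 * c i) • ((1 / 2 : ℝ) • ((b i : W) : EuclideanSpace ℝ (Fin n)) - η i) := by
    nth_rewrite 1 [hw']
    rw [← Finset.sum_sub_distrib]
    refine Finset.sum_congr rfl fun i _ => ?_
    rw [smul_sub, smul_smul]
    congr 2
    ring
  have hnorm : √(∑ i, |c i| ^ 2) = ‖w‖ := by
    have h := b.sum_sq_norm_inner_right (⟨w, hw⟩ : W)
    have h' : ∑ i, |c i| ^ 2 = ‖w‖ ^ 2 := by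
      simpa [hc] using h
    rw [h', Real.sqrt_sq (norm_nonneg w)]
  have hCS : ∑ i, |c i| ≤ ‖w‖ * √(Module.finrank ℝ W) := by
    have h := Real.sum_mul_le_sqrt_mul_sqrt Finset.univ (fun i => |c i|) fun _ => 1
    simp only [hnorm] at h
    simpa using h
  rw [hdiff]
  calc ‖∑ i, (2 * c i) • ((1 / 2 : ℝ) • ((b i : W) : EuclideanSpace ℝ (Fin n)) - η i)‖
      ≤ ∑ i, 2 * |c i| * (√n * Q⁻¹) := by
        refine norm_sum_le_of_le _ fun i _ => ?_
        rw [norm_smul, norm_mul, Real.norm_eq_abs, Real.norm_eq_abs, abs_two]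
        gcongr
        exact hηb i
    _ = 2 * (∑ i, |c i|) * (√n * Q⁻¹) := by rw [← Finset.sum_mul, Finset.mul_sum]
    _ ≤ 2 * (‖w‖ * √(Module.finrank ℝ W)) * (√n * Q⁻¹) := by gcongr
    _ = _ := by ring

/-! ### Lifting to `ℝⁿ` -/

theorem exists_lift_norm_eq {n : ℕ} (ζ : Torus n) :
    ∃ z : EuclideanSpace ℝ (Fin n), toTorus z = ζ ∧ ‖z‖ = ‖ζ‖ := by
  have h : ∀ t : UnitAddCircle, ∃ x : ℝ, (x : UnitAddCircle) = t ∧ ‖x‖ = ‖t‖ := by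
    intro t
    obtain ⟨x, rfl⟩ := QuotientAddGroup.mk_surjective t
    refine ⟨x - round x, ?_, (UnitAddCircle.norm_eq (x := x)).symm⟩
    rw [AddCircle.coe_sub, sub_eq_self]
    exact AddCircle.coe_eq_zero_iff (1 : ℝ) |>.mpr ⟨round x, by simp⟩
  choose x hx hxn using fun i => h (ζ i)
  refine ⟨WithLp.toLp 2 x, ?_, ?_⟩
  · ext i
    exact hx i
  · rw [PiLp.norm_eq_of_L2, PiLp.norm_eq_of_L2]
    congr 1
    exact Finset.sum_congr rfl fun i _ => by rw [← hxn i]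

theorem dist_toTorus_le {n : ℕ} (v w : EuclideanSpace ℝ (Fin n)) :
    dist (toTorus v) (toTorus w) ≤ ‖v - w‖ := by
  rw [PiLp.dist_eq_of_L2, PiLp.norm_eq_of_L2]
  refine Real.sqrt_le_sqrt (Finset.sum_le_sum fun i _ => ?_)
  refine pow_le_pow_left₀ dist_nonneg ?_ 2
  rw [dist_eq_norm]
  change ‖((v i : UnitAddCircle) - (w i : UnitAddCircle))‖ ≤ ‖v i - w i‖
  rw [← AddCircle.coe_sub]
  exact QuotientAddGroup.norm_mk_le_norm

theorem infDist_spanTorus_le {n ℓ : ℕ} {η : Fin ℓ → EuclideanSpace ℝ (Fin n)}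
    {w : EuclideanSpace ℝ (Fin n)} (hw : w ∈ Submodule.span ℝ (Set.range η))
    (z : EuclideanSpace ℝ (Fin n)) :
    Metric.infDist (toTorus z) (spanTorus η) ≤ ‖z - w‖ :=
  (Metric.infDist_le_dist_of_mem (Set.mem_image_of_mem toTorus hw)).trans (dist_toTorus_le z w)

end NearOriginSpectrum

theorem mainTheorem7 (n : ℕ) (hn : 1 ≤ n) (R K α κ B Q S ρ : ℝ)
    (hR : 2 ≤ R) (hK : 2 ≤ K) (hα0 : 0 < α) (hα1 : α ≤ 1) (hκ : 0 < κ) (hB : 1 ≤ B)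
    (μ : PMF (Fin n → ℤ))
    (hμ : NearOriginSpectrum.IsDensePiece α μ
      (NearOriginSpectrum.discreteGaussian n R (lt_of_lt_of_le two_pos hR)))
    (hS : S = Real.logb 2 (2 / α))
    (hρ : ρ = 100 * B * S ^ (3 / 2 : ℝ) * κ / Real.sqrt K)
    (hκ_lower : 3 * Real.sqrt S / R ≤ κ)
    (hκ_upper : κ ≤ Real.sqrt (2 * Real.pi / (K * Real.log (8 * (n : ℝ)))))
    (hQ : 2 * Real.sqrt (2 * (n : ℝ) * S) * κ / ρ ≤ Q) :
    ∃ (ℓ : ℕ) (η : Fin ℓ → EuclideanSpace ℝ (Fin n)),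
      (ℓ : ℝ) ≤ 2 * S / Real.logb 2 (2 * B) ∧
      (∀ i, η i ∈ NearOriginSpectrum.boundedGrid n Q) ∧
      ∀ ζ ∈ NearOriginSpectrum.nearOriginLargeSpectrum K κ μ,
        Metric.infDist ζ (NearOriginSpectrum.spanTorus η) ≤ 2 * ρ := by
  open NearOriginSpectrum in
  have hn' : (1 : ℝ) ≤ n := by exact_mod_cast hn
  have hR0 : 0 < R := by linarith
  have hK0 : 0 < K := by linarith
  have hsK : 0 < √K := Real.sqrt_pos.mpr hK0
  have hS1 : 1 ≤ S := by
    rw [hS, Real.le_logb_iff_rpow_le one_lt_two (by positivity), Real.rpow_one,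
      le_div_iff₀ hα0]
    linarith
  have hlogB : 1 ≤ Real.logb 2 (2 * B) := by
    rw [Real.le_logb_iff_rpow_le one_lt_two (by positivity), Real.rpow_one]
    linarith
  have hS32 : S ≤ S ^ (3 / 2 : ℝ) := Real.self_le_rpow_of_one_le hS1 (by norm_num)
  have hρ0 : 0 < ρ := by rw [hρ]; positivity
  rcases le_or_gt κ (2 * ρ) with hκρ | hκρ
  · -- the whole ball of radius `κ` is within `2ρ` of the origin
    refine ⟨0, Fin.elim0, by rw [Nat.cast_zero]; positivity, fun i => i.elim0, fun ζ hζ => ?_⟩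
    obtain ⟨z, rfl, hz⟩ := exists_lift_norm_eq ζ
    refine (infDist_spanTorus_le (Submodule.zero_mem _) z).trans ?_
    rw [sub_zero, hz]
    exact hζ.2.trans hκρ
  have hBK : 200 * B ≤ √K := by
    rw [hρ, mul_div_assoc', div_lt_iff₀ hsK] at hκρ
    have h1 : κ * (200 * (B * S ^ (3 / 2 : ℝ))) < κ * √K := by linarith
    have h2 := lt_of_mul_lt_mul_left h1 hκ.le
    have h3 : B ≤ B * S ^ (3 / 2 : ℝ) := le_mul_of_one_le_right (by linarith) (hS1.trans hS32)
    linarith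
  have hκR : 3 ≤ κ * R := by
    rw [div_le_iff₀ hR0] at hκ_lower
    have : 1 ≤ √S := Real.one_le_sqrt.mpr hS1
    linarith
  have hlog : 0 < Real.log (8 * n) := Real.log_pos (by linarith)
  have hκK : κ ^ 2 * (K * Real.log (8 * n)) ≤ 2 * Real.pi := by
    rw [Real.le_sqrt hκ.le (by positivity), le_div_iff₀ (by positivity)] at hκ_upper
    exact hκ_upper
  have hRρ : 300 * B / √K ≤ R * ρ := by
    rw [hρ, mul_div_assoc']
    refine div_le_div_of_nonneg_right ?_ hsK.le
    have h1 : B * 3 ≤ B * S ^ (3 / 2 : ℝ) * (κ * R) := by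
      refine mul_le_mul (le_mul_of_one_le_right (by linarith) (hS1.trans hS32)) hκR (by norm_num)
        (by positivity)
    linarith
  obtain ⟨z, m, hm, hclose⟩ := exists_prefixSpan_close
    (Z := {v : EuclideanSpace ℝ (Fin n) | toTorus v ∈ nearOriginLargeSpectrum K κ μ ∧ ‖v‖ ≤ κ})
    (ρ := ρ) (N := S / Real.logb 2 (2 * B)) fun z m hz => by
      have h := two_mul_pow_le hn hR hα0 hκ hB hρ0 hμ hκR hκK hBK hRρ z (residual z) m
        (fun j hj => ⟨(hz j hj).1.1.1, (hz j hj).1.2⟩)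
        (fun j _ i hi => inner_residual_of_lt z hi) (fun j _ => inner_residual_self z j)
        (fun j hj => (hz j hj).2.le)
      rw [le_div_iff₀ (by linarith), ← Real.logb_pow, hS]
      exact Real.logb_le_logb_of_le one_lt_two (by positivity) h
  set W := prefixSpan z m with hW
  have hℓ : (Module.finrank ℝ W : ℝ) ≤ S / Real.logb 2 (2 * B) :=
    le_trans (by exact_mod_cast finrank_prefixSpan_le z m) hm
  have hℓS : (Module.finrank ℝ W : ℝ) ≤ 2 * S := by
    have := div_le_self (by linarith : (0 : ℝ) ≤ S) hlogB
    linarith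
  have hQ0 : 0 < Q := lt_of_lt_of_le (by positivity) hQ
  obtain ⟨η, hη, hηW⟩ := exists_boundedGrid_span_close hQ0 W
  refine ⟨_, η, ?_, hη, fun ζ hζ => ?_⟩
  · rw [mul_div_assoc]
    have : 0 ≤ S / Real.logb 2 (2 * B) := by positivity
    linarith
  obtain ⟨v, rfl, hv⟩ := exists_lift_norm_eq ζ
  have hvκ : ‖v‖ ≤ κ := hv.trans_le hζ.2
  obtain ⟨w, hw, hwv⟩ := hηW _ (W.starProjection_apply_mem v)
  have hround : 2 * κ * √(Module.finrank ℝ W) * (√n * Q⁻¹) ≤ ρ := by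
    rw [div_le_iff₀ hρ0] at hQ
    have h1 : √(Module.finrank ℝ W) * √n ≤ √(2 * n * S) := by
      rw [← Real.sqrt_mul (Nat.cast_nonneg _)]
      refine Real.sqrt_le_sqrt ?_
      nlinarith
    have h2 : 2 * κ * √(Module.finrank ℝ W) * (√n * Q⁻¹) =
        2 * (√(Module.finrank ℝ W) * √n) * κ / Q := by ring
    rw [h2, div_le_iff₀ hQ0]
    calc 2 * (√(Module.finrank ℝ W) * √n) * κ ≤ 2 * √(2 * n * S) * κ := by gcongr
      _ ≤ ρ * Q := by linarith
  calc Metric.infDist (toTorus v) (spanTorus η) ≤ ‖v - w‖ := infDist_spanTorus_le hw v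
    _ ≤ ‖v - W.starProjection v‖ + ‖W.starProjection v - w‖ :=
        norm_sub_le_norm_sub_add_norm_sub _ _ _
    _ ≤ ρ + 2 * κ * √(Module.finrank ℝ W) * (√n * Q⁻¹) := by
        refine add_le_add (hclose v ⟨hζ, hvκ⟩) (hwv.trans ?_)
        gcongr
        exact (W.norm_starProjection_apply_le v).trans hvκ
    _ ≤ 2 * ρ := by linarith
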